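/- **Theorem 1.1.** For $n\ge 0$ let $a(n)$ be the number of cubic partitions of $n$, i.e. partitions of $n$ in which the even parts come in two colours. Write $(c;q)_\infty=\prod_{k=0}^{\infty}(1-cq^k)$. Then for every complex $q$ with $|q|<1$ the two series below converge, and $$\sum_{n=0}^{\infty}a(n)q^n=\prod_{n=1}^{\infty}\frac{1}{(1-q^n)(1-q^{2n})},$$ $$\sum_{n=0}^{\infty}a(3n+2)q^n=3\,\frac{(q^3;q^3)_\infty^3\,(q^6;q^6)_\infty^3}{(q;q)_\infty^4\,(q^2;q^2)_\infty^4}.$$ -/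

import Mathlib

/-- The number `a(n)` of cubic partitions of `n`: partitions of `n` whose even parts come in two
colours. Such a partition is a pair consisting of a partition of some `i` (the parts of the first
colour) and a partition of some `j` into even parts (the parts of the second colour), with
`i + j = n`. -/
def cubicPartitionCount (n : ℕ) : ℕ :=
  ∑ ij ∈ Finset.HasAntidiagonal.antidiagonal n,
    Fintype.card (Nat.Partition ij.1) * (Nat.Partition.restricted ij.2 Even).card

/-- The infinite `q`-shifted factorial `(c; q)_∞ = ∏_{k ≥ 0} (1 - c q ^ k)`, which converges for
`‖q‖ < 1`. -/
noncomputable def qPochhammerInf (c q : ℂ) : ℂ :=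
  ∏' k : ℕ, (1 - c * q ^ k)

open Filter Topology Finset

/-! Put E(q) = (q;q)_∞ (q²;q²)_∞, so that 1/E generates the cubic partitions. Euler's identity
factors E(q) as φ(-q)ψ(q), and the Jacobi triple product splits each factor by exponents mod 3.
Multiplying gives E(q) = a - q r - 2q² c (`eulerPair_dissection`), where a, r, c are series in q³, r
= E(q⁹), and ac = r² (`theta_mul_theta`).

Averaging 1/E over q, ωq, ω²q, for ω a primitive cube root of unity, isolates the exponents that are
2 mod 3. The common denominator is E(q)E(ωq)E(ω²q) = E(q³)⁴/E(q⁹) (`eulerPair_mul_cube_roots`). The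
numerator is 3(q²r² + 2q²ac) = 9q²r², a single term because ac = r². Hence the part sought is 3q²
E(q⁹)³/E(q³)⁴; dividing by q² and replacing q³ by q finishes.

The formal generating function becomes an analytic one through `HasEval`: nonnegative coefficients
increase along the partial products, so bounded values at ‖q‖ give absolute convergence. -/

/-! ### Infinite q-shifted factorials -/

theorem multipliable_qPochhammerInf (c : ℂ) {q : ℂ} (hq : ‖q‖ < 1) :
    Multipliable fun k : ℕ => 1 - c * q ^ k := by
  have h : Summable fun k : ℕ => ‖-(c * q ^ k)‖ := by
    simpa using (summable_geometric_of_lt_one (norm_nonneg _) hq).mul_left ‖c‖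
  simpa [sub_eq_add_neg] using multipliable_one_add_of_summable h

theorem hasProd_qPochhammerInf (c : ℂ) {q : ℂ} (hq : ‖q‖ < 1) :
    HasProd (fun k : ℕ => 1 - c * q ^ k) (qPochhammerInf c q) :=
  (multipliable_qPochhammerInf c hq).hasProd

theorem tendsto_qPochhammerInf (c : ℂ) {q : ℂ} (hq : ‖q‖ < 1) :
    Tendsto (fun N => ∏ k ∈ range N, (1 - c * q ^ k)) atTop (𝓝 (qPochhammerInf c q)) :=
  (hasProd_qPochhammerInf c hq).tendsto_prod_nat

theorem one_sub_ne_zero_of_norm_lt_one {x : ℂ} (hx : ‖x‖ < 1) : 1 - x ≠ 0 := by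
  rw [sub_ne_zero]
  rintro rfl
  simp at hx

theorem norm_mul_pow_lt_one {c q : ℂ} (hc : ‖c‖ < 1) (hq : ‖q‖ < 1) (k : ℕ) :
    ‖c * q ^ k‖ < 1 := by
  rw [norm_mul, norm_pow]
  exact mul_lt_one_of_nonneg_of_lt_one_left (norm_nonneg _) hc
    (pow_le_one₀ (norm_nonneg _) hq.le)

theorem qPochhammerInf_ne_zero {c q : ℂ} (hc : ‖c‖ < 1) (hq : ‖q‖ < 1) :
    qPochhammerInf c q ≠ 0 := by
  have h : Summable fun k : ℕ => ‖-(c * q ^ k)‖ := by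
    simpa using (summable_geometric_of_lt_one (norm_nonneg _) hq).mul_left ‖c‖
  have := tprod_one_add_ne_zero_of_summable (f := fun k : ℕ => -(c * q ^ k))
    (fun k => by
      rw [← sub_eq_add_neg]
      exact one_sub_ne_zero_of_norm_lt_one (norm_mul_pow_lt_one hc hq k)) h
  simpa [qPochhammerInf, sub_eq_add_neg] using this

theorem norm_pow_lt_one {q : ℂ} (hq : ‖q‖ < 1) {n : ℕ} (hn : n ≠ 0) : ‖q ^ n‖ < 1 := by
  rw [norm_pow]
  exact pow_lt_one₀ (norm_nonneg _) hq hn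

/-- The shifted factorial loses its first factor when `c` is replaced by `c * q`. -/
theorem qPochhammerInf_eq_one_sub_mul (c : ℂ) {q : ℂ} (hq : ‖q‖ < 1) :
    qPochhammerInf c q = (1 - c) * qPochhammerInf (c * q) q := by
  refine tendsto_nhds_unique ((tendsto_qPochhammerInf c hq).comp (tendsto_add_atTop_nat 1)) ?_
  convert (tendsto_qPochhammerInf (c * q) hq).const_mul (1 - c) using 2 with N
  simp [prod_range_succ', mul_comm, pow_succ, mul_assoc]

theorem qPochhammerInf_mul_neg (c : ℂ) {q : ℂ} (hq : ‖q‖ < 1) :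
    qPochhammerInf c q * qPochhammerInf (-c) q = qPochhammerInf (c ^ 2) (q ^ 2) := by
  refine tendsto_nhds_unique ((tendsto_qPochhammerInf c hq).mul (tendsto_qPochhammerInf (-c) hq)) ?_
  convert tendsto_qPochhammerInf (c ^ 2) (norm_pow_lt_one hq two_ne_zero) using 2 with N
  rw [← prod_mul_distrib]
  refine prod_congr rfl fun k _ => ?_
  ring

theorem qPochhammerInf_split_two (c : ℂ) {q : ℂ} (hq : ‖q‖ < 1) :
    qPochhammerInf c q = qPochhammerInf c (q ^ 2) * qPochhammerInf (c * q) (q ^ 2) := by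
  have h2 := norm_pow_lt_one hq two_ne_zero
  have ht : Tendsto (fun N : ℕ => N * 2) atTop atTop :=
    tendsto_id.atTop_mul_const' (by norm_num)
  refine tendsto_nhds_unique ((tendsto_qPochhammerInf c hq).comp ht) ?_
  convert (tendsto_qPochhammerInf c h2).mul (tendsto_qPochhammerInf (c * q) h2) using 2 with N
  simp only [Function.comp]
  induction N with
  | zero => simp
  | succ N ih =>
    rw [add_mul, one_mul, prod_range_succ, prod_range_succ, ih, prod_range_succ, prod_range_succ]
    ring

theorem qPochhammerInf_split_three (c : ℂ) {q : ℂ} (hq : ‖q‖ < 1) :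
    qPochhammerInf c q = qPochhammerInf c (q ^ 3) * qPochhammerInf (c * q) (q ^ 3) *
      qPochhammerInf (c * q ^ 2) (q ^ 3) := by
  have h3 := norm_pow_lt_one hq three_ne_zero
  have ht : Tendsto (fun N : ℕ => N * 3) atTop atTop :=
    tendsto_id.atTop_mul_const' (by norm_num)
  refine tendsto_nhds_unique ((tendsto_qPochhammerInf c hq).comp ht) ?_
  convert ((tendsto_qPochhammerInf c h3).mul (tendsto_qPochhammerInf (c * q) h3)).mul
    (tendsto_qPochhammerInf (c * q ^ 2) h3) using 2 with N
  simp only [Function.comp]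
  induction N with
  | zero => simp
  | succ N ih =>
    rw [add_mul, one_mul, prod_range_succ, prod_range_succ, prod_range_succ, ih, prod_range_succ,
      prod_range_succ, prod_range_succ]
    ring

theorem qPochhammerInf_mul_cube_roots {ω : ℂ} (hω : 1 + ω + ω ^ 2 = 0) (c : ℂ) {q : ℂ}
    (hq : ‖q‖ < 1) :
    qPochhammerInf c q * qPochhammerInf (ω * c) q * qPochhammerInf (ω ^ 2 * c) q =
      qPochhammerInf (c ^ 3) (q ^ 3) := by
  refine tendsto_nhds_unique (((tendsto_qPochhammerInf c hq).mul
    (tendsto_qPochhammerInf (ω * c) hq)).mul (tendsto_qPochhammerInf (ω ^ 2 * c) hq)) ?_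
  convert tendsto_qPochhammerInf (c ^ 3) (norm_pow_lt_one hq three_ne_zero) using 2 with N
  rw [← prod_mul_distrib, ← prod_mul_distrib]
  refine prod_congr rfl fun k _ => ?_
  have h2 : ω ^ 2 = -1 - ω := by linear_combination hω
  rw [← pow_mul, mul_comm 3 k, pow_mul]
  generalize q ^ k = y
  rw [h2]
  linear_combination (-(c * y) ^ 2 + (c * y) ^ 3) * h2

/-! ### The Jacobi triple product -/

/-- `1 / ((1 - q) ⋯ (1 - q ^ n))`, extended by zero to negative `n`. -/
noncomputable def invQFactorial (q : ℂ) : ℤ → ℂ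
  | .ofNat n => (∏ k ∈ range n, (1 - q * q ^ k))⁻¹
  | .negSucc _ => 0

theorem invQFactorial_natCast (q : ℂ) (n : ℕ) :
    invQFactorial q n = (∏ k ∈ range n, (1 - q * q ^ k))⁻¹ := rfl

theorem invQFactorial_of_neg (q : ℂ) {n : ℤ} (hn : n < 0) : invQFactorial q n = 0 := by
  obtain ⟨m, rfl⟩ := Int.eq_negSucc_of_lt_zero hn
  rfl

/-- At n = 0 the factor 1 - q⁰ vanishes, in agreement with the extension by zero. The recurrence
thus holds on all of ℤ, and the finite triple product needs no boundary cases. -/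
theorem invQFactorial_sub_one {q : ℂ} (hq : ‖q‖ < 1) (n : ℤ) :
    invQFactorial q (n - 1) = (1 - q ^ n) * invQFactorial q n := by
  rcases lt_trichotomy n 0 with h | rfl | h
  · rw [invQFactorial_of_neg q h, invQFactorial_of_neg q (by omega), mul_zero]
  · rw [invQFactorial_of_neg q (by omega)]
    simp
  · obtain ⟨m, rfl⟩ : ∃ m : ℕ, n = (m + 1 : ℕ) := ⟨(n - 1).toNat, by omega⟩
    have h1 : ((m + 1 : ℕ) : ℤ) - 1 = m := by push_cast; ring
    have h2 : 1 - q ^ (m + 1) ≠ 0 :=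
      one_sub_ne_zero_of_norm_lt_one (norm_pow_lt_one hq m.succ_ne_zero)
    rw [h1, invQFactorial_natCast, invQFactorial_natCast, prod_range_succ, zpow_natCast, mul_inv,
      ← pow_succ', mul_comm (_⁻¹), mul_inv_cancel_left₀ h2]

theorem tendsto_invQFactorial {q : ℂ} (hq : ‖q‖ < 1) :
    Tendsto (invQFactorial q) atTop (𝓝 (qPochhammerInf q q)⁻¹) := by
  rw [← Nat.map_cast_int_atTop, tendsto_map'_iff]
  exact (tendsto_qPochhammerInf q hq).inv₀ (qPochhammerInf_ne_zero hq hq)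

theorem exists_norm_invQFactorial_le {q : ℂ} (hq : ‖q‖ < 1) :
    ∃ C, ∀ n, ‖invQFactorial q n‖ ≤ C := by
  have h : Tendsto (fun n : ℕ => ‖invQFactorial q n‖) atTop (𝓝 ‖(qPochhammerInf q q)⁻¹‖) :=
    ((tendsto_invQFactorial hq).comp tendsto_natCast_atTop_atTop).norm
  obtain ⟨C, hC⟩ := h.bddAbove_range
  refine ⟨C, fun n => ?_⟩
  rcases lt_or_ge n 0 with hn | hn
  · rw [invQFactorial_of_neg q hn, norm_zero]
    exact (norm_nonneg _).trans (hC ⟨0, rfl⟩)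
  · lift n to ℕ using hn
    exact hC ⟨n, rfl⟩

/-- The general term of the Jacobi triple product series. -/
noncomputable def jacobiTerm (q z : ℂ) (j : ℤ) : ℂ :=
  (-1) ^ j * q ^ (j * (j - 1) / 2) * z ^ j

theorem triangle_succ (j : ℤ) : (j + 1) * (j + 1 - 1) / 2 = j * (j - 1) / 2 + j := by
  rw [show (j + 1) * (j + 1 - 1) = j * (j - 1) + j * 2 by ring, Int.add_mul_ediv_right _ _ two_ne_zero]

theorem jacobiTerm_add_one {q z : ℂ} (hq : q ≠ 0) (hz : z ≠ 0) (j : ℤ) :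
    jacobiTerm q z (j + 1) = -(z * q ^ j) * jacobiTerm q z j := by
  rw [jacobiTerm, jacobiTerm, triangle_succ, zpow_add₀ hq, zpow_add_one₀ hz,
    zpow_add_one₀ (by norm_num)]
  ring

theorem summable_norm_of_ratio {f : ℕ → ℂ} {r w : ℂ} (hr : ‖r‖ < 1) (hf : ∀ n, f n ≠ 0)
    (h : ∀ n, f (n + 1) = w * r ^ n * f n) : Summable fun n => ‖f n‖ := by
  refine summable_of_ratio_test_tendsto_lt_one (l := 0) zero_lt_one
    (Eventually.of_forall fun n => by simpa using hf n) ?_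
  have : Tendsto (fun n : ℕ => ‖w‖ * ‖r‖ ^ n) atTop (𝓝 (‖w‖ * 0)) :=
    (tendsto_pow_atTop_nhds_zero_of_lt_one (norm_nonneg _) hr).const_mul _
  rw [mul_zero] at this
  refine this.congr fun n => ?_
  have h0 : ‖f n‖ ≠ 0 := by simpa using hf n
  rw [h, norm_norm, norm_norm, norm_mul, norm_mul, norm_pow, mul_div_cancel_right₀ _ h0]

theorem summable_norm_jacobiTerm {q z : ℂ} (hq : ‖q‖ < 1) (hq0 : q ≠ 0) (hz : z ≠ 0) :
    Summable fun j => ‖jacobiTerm q z j‖ := by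
  have hne (j) : jacobiTerm q z j ≠ 0 :=
    mul_ne_zero (mul_ne_zero (zpow_ne_zero _ (by norm_num)) (zpow_ne_zero _ hq0))
      (zpow_ne_zero _ hz)
  refine Summable.of_nat_of_neg ?_ ?_
  · refine summable_norm_of_ratio (w := -z) hq (fun n => hne n) fun n => ?_
    rw [Nat.cast_succ, jacobiTerm_add_one hq0 hz, zpow_natCast]
    ring
  · refine summable_norm_of_ratio (w := -(q / z)) hq (fun n => hne _) fun n => ?_
    have := jacobiTerm_add_one hq0 hz (-(n : ℤ) - 1)
    rw [sub_add_cancel] at this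
    rw [Nat.cast_succ, neg_add', this, zpow_sub_one₀ hq0, zpow_neg, zpow_natCast]
    field_simp

/-- A finite form of the Jacobi triple product identity. -/
theorem hasSum_jacobi_finite {q z : ℂ} (hq : ‖q‖ < 1) (hq0 : q ≠ 0) (hz : z ≠ 0) (N : ℕ) :
    HasSum (fun j : ℤ => jacobiTerm q z j * ((∏ k ∈ range (N * 2), (1 - q * q ^ k)) *
      invQFactorial q (N - j) * invQFactorial q (N + j)))
      ((∏ k ∈ range N, (1 - z * q ^ k)) * ∏ k ∈ range N, (1 - q / z * q ^ k)) := by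
  induction N with
  | zero =>
    convert hasSum_single (0 : ℤ) ?_ using 1
    · simp [jacobiTerm, show invQFactorial q 0 = 1 by
        simpa using invQFactorial_natCast q 0]
    · intro j hj
      rcases lt_or_gt_of_ne hj with h | h
      · rw [invQFactorial_of_neg q (n := (0 : ℕ) + j) (by simpa using h)]; ring
      · rw [invQFactorial_of_neg q (n := (0 : ℕ) - j) (by simpa using h)]; ring
  | succ N ih =>
    -- The two new factors multiply out to 1 + q^(2N+1) - z q^N - q^(N+1)/z. Shifting the index by
    -- one absorbs the powers of z in the last two terms.
    have hp := ((Equiv.addRight (1 : ℤ)).hasSum_iff.mpr ih).mul_left (-(q ^ (N + 1) / z))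
    have hm := ((Equiv.subRight (1 : ℤ)).hasSum_iff.mpr ih).mul_left (-(z * q ^ N))
    have h0 := ih.mul_left (1 + q ^ (2 * N + 1))
    refine Eq.mp (congrArg₂ (fun f s => HasSum f s) (funext fun j => Eq.symm ?_) (Eq.symm ?_))
      ((h0.add hm).add hp)
    · have hj1 := jacobiTerm_add_one hq0 hz j
      have hj2 := jacobiTerm_add_one hq0 hz (j - 1)
      rw [sub_add_cancel, zpow_sub_one₀ hq0] at hj2
      simp only [Function.comp, Equiv.coe_addRight, Equiv.subRight_apply]
      have e1 := invQFactorial_sub_one hq (N + 1 - j)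
      have e2 := invQFactorial_sub_one hq (N + 1 + j)
      have e3 := invQFactorial_sub_one hq (N - j)
      have e4 := invQFactorial_sub_one hq (N + j)
      rw [show (N : ℤ) + 1 - j - 1 = N - j by ring] at e1
      rw [show (N : ℤ) + 1 + j - 1 = N + j by ring] at e2
      rw [show (N : ℤ) - (j + 1) = N - j - 1 by ring, show (N : ℤ) + (j - 1) = N + j - 1 by ring,
        show (N : ℤ) - (j - 1) = N + 1 - j by ring, show (N : ℤ) + (j + 1) = N + 1 + j by ring,
        e3, e4, e1, e2, hj1, Nat.cast_succ, add_mul, one_mul, prod_range_succ, prod_range_succ]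
      have hj0 : jacobiTerm q z (j - 1) = -(q / (z * q ^ j)) * jacobiTerm q z j := by
        rw [hj2]; field_simp
      rw [hj0]
      simp only [zpow_sub₀ hq0, zpow_add₀ hq0, zpow_natCast, zpow_one]
      have hqj : q ^ j ≠ 0 := zpow_ne_zero _ hq0
      generalize q ^ j = y at *
      rw [mul_comm N 2]
      simp only [pow_add, pow_mul', pow_one]
      generalize q ^ N = x
      field_simp
      ring
    · rw [prod_range_succ, prod_range_succ]
      simp only [pow_add, pow_mul', pow_one]
      field_simp
      ring

/-- **The Jacobi triple product identity.** -/
theorem hasSum_jacobiTerm {q z : ℂ} (hq : ‖q‖ < 1) (hq0 : q ≠ 0) (hz : z ≠ 0) :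
    HasSum (jacobiTerm q z)
      (qPochhammerInf z q * qPochhammerInf (q / z) q * qPochhammerInf q q) := by
  have hE := qPochhammerInf_ne_zero hq hq
  have ht : Tendsto (fun N : ℕ => N * 2) atTop atTop :=
    tendsto_id.atTop_mul_const' (by norm_num)
  have hlim := (tendsto_qPochhammerInf q hq).comp ht
  obtain ⟨C, hC⟩ := exists_norm_invQFactorial_le hq
  obtain ⟨B, hB⟩ := hlim.norm.bddAbove_range
  have hsum := summable_norm_jacobiTerm hq hq0 hz
  -- Dominated convergence in the finite identity: for fixed j the weight tends to (q;q)_∞ /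
  -- (q;q)_∞², and B * C * C bounds it uniformly in j and N.
  have key : Tendsto (fun N : ℕ => ∑' j : ℤ, jacobiTerm q z j *
      ((∏ k ∈ range (N * 2), (1 - q * q ^ k)) * invQFactorial q (N - j) * invQFactorial q (N + j)))
      atTop (𝓝 (∑' j, jacobiTerm q z j * (qPochhammerInf q q)⁻¹)) := by
    refine tendsto_tsum_of_dominated_convergence (hsum.mul_right (B * C * C)) (fun j => ?_) ?_
    · have h1 : Tendsto (fun N : ℕ => invQFactorial q (N - j)) atTop (𝓝 (qPochhammerInf q q)⁻¹) :=
        (tendsto_invQFactorial hq).comp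
          (tendsto_atTop_add_const_right _ (-j) tendsto_natCast_atTop_atTop)
      have h2 : Tendsto (fun N : ℕ => invQFactorial q (N + j)) atTop (𝓝 (qPochhammerInf q q)⁻¹) :=
        (tendsto_invQFactorial hq).comp
          (tendsto_atTop_add_const_right _ j tendsto_natCast_atTop_atTop)
      have h3 := ((hlim.mul h1).mul h2).const_mul (jacobiTerm q z j)
      rwa [mul_inv_cancel₀ hE, one_mul] at h3
    · refine Eventually.of_forall fun N j => ?_
      have hB' : ‖∏ k ∈ range (N * 2), (1 - q * q ^ k)‖ ≤ B := hB ⟨N, rfl⟩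
      rw [norm_mul, norm_mul, norm_mul]
      have hB0 := (norm_nonneg _).trans hB'
      have hC0 := (norm_nonneg _).trans (hC 0)
      gcongr
      exacts [hC _, hC _]
  have h := tendsto_nhds_unique key (((tendsto_qPochhammerInf z hq).mul
    (tendsto_qPochhammerInf (q / z) hq)).congr fun N =>
      (hasSum_jacobi_finite hq hq0 hz N).tsum_eq.symm)
  rw [tsum_mul_right, mul_inv_eq_iff_eq_mul₀ hE] at h
  rw [← h]
  exact hsum.of_norm.hasSum

/-! ### Theta functions and their 3-dissections -/

/-- Ramanujan's theta function `φ(-q)` as an infinite product. -/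
noncomputable def thetaPhi (q : ℂ) : ℂ :=
  qPochhammerInf q (q ^ 2) ^ 2 * qPochhammerInf (q ^ 2) (q ^ 2)

/-- Ramanujan's theta function `ψ(q)` as an infinite product. -/
noncomputable def thetaPsi (q : ℂ) : ℂ :=
  qPochhammerInf (-q) q ^ 2 * qPochhammerInf q q

/-- The product form of `∑ (-1) ^ m q ^ (3 m ^ 2 + 2 m)`. -/
noncomputable def thetaOmega (q : ℂ) : ℂ :=
  qPochhammerInf q (q ^ 6) * qPochhammerInf (q ^ 5) (q ^ 6) * qPochhammerInf (q ^ 6) (q ^ 6)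

/-- The product form of `∑ q ^ (m (3 m + 1) / 2)`. -/
noncomputable def thetaA (q : ℂ) : ℂ :=
  qPochhammerInf (-q) (q ^ 3) * qPochhammerInf (-q ^ 2) (q ^ 3) * qPochhammerInf (q ^ 3) (q ^ 3)

/-- This is the square of Euler's identity (q;q²)_∞ (-q;q)_∞ = 1, which is `e3`. -/
theorem thetaPhi_mul_thetaPsi {q : ℂ} (hq : ‖q‖ < 1) :
    thetaPhi q * thetaPsi q = qPochhammerInf q q * qPochhammerInf (q ^ 2) (q ^ 2) := by
  have h2 := norm_pow_lt_one hq two_ne_zero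
  have e1 := qPochhammerInf_split_two q hq
  have e2 := qPochhammerInf_mul_neg q hq
  rw [← sq] at e1
  have hne := qPochhammerInf_ne_zero h2 h2
  have e3 : qPochhammerInf q (q ^ 2) * qPochhammerInf (-q) q = 1 := by
    refine mul_right_cancel₀ hne ?_
    linear_combination e2 - qPochhammerInf (-q) q * e1
  rw [thetaPhi, thetaPsi]
  linear_combination (qPochhammerInf (q ^ 2) (q ^ 2) * qPochhammerInf q q *
    (qPochhammerInf q (q ^ 2) * qPochhammerInf (-q) q + 1)) * e3

/-- Euler's cancellation again, now in base q³ for the residues 1 and 2: the factors (q²;q⁶)_∞ and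
(q⁴;q⁶)_∞ appear on both sides and cancel. -/
theorem thetaOmega_mul_thetaA {q : ℂ} (hq : ‖q‖ < 1) :
    thetaOmega q * thetaA q =
      qPochhammerInf (q ^ 3) (q ^ 3) * qPochhammerInf (q ^ 6) (q ^ 6) := by
  have h3 := norm_pow_lt_one hq three_ne_zero
  have h6 := norm_pow_lt_one hq (n := 6) (by norm_num)
  have h2 := norm_pow_lt_one hq two_ne_zero
  have h4 := norm_pow_lt_one hq four_ne_zero
  have a1 := qPochhammerInf_mul_neg q h3
  have a2 := qPochhammerInf_mul_neg (q ^ 2) h3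
  have s1 := qPochhammerInf_split_two q h3
  have s2 := qPochhammerInf_split_two (q ^ 2) h3
  have n2 := qPochhammerInf_ne_zero h2 h6
  have n4 := qPochhammerInf_ne_zero h4 h6
  simp only [← pow_mul, ← pow_add, ← pow_succ'] at a1 a2 s1 s2
  norm_num at a1 a2 s1 s2
  rw [s1] at a1
  rw [s2] at a2
  have key : qPochhammerInf (-q) (q ^ 3) * qPochhammerInf (-q ^ 2) (q ^ 3) *
      (qPochhammerInf q (q ^ 6) * qPochhammerInf (q ^ 5) (q ^ 6)) = 1 := by
    refine mul_right_cancel₀ (mul_ne_zero n2 n4) ?_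
    linear_combination (qPochhammerInf (q ^ 2) (q ^ 6) * qPochhammerInf (q ^ 5) (q ^ 6) *
      qPochhammerInf (-q ^ 2) (q ^ 3)) * a1 + qPochhammerInf (q ^ 2) (q ^ 6) * a2
  rw [thetaOmega, thetaA]
  linear_combination (qPochhammerInf (q ^ 3) (q ^ 3) * qPochhammerInf (q ^ 6) (q ^ 6)) * key

theorem HasSum.int_mod_three {f : ℤ → ℂ} {a b c : ℂ} (h0 : HasSum (fun m => f (3 * m)) a)
    (h1 : HasSum (fun m => f (3 * m + 1)) b) (h2 : HasSum (fun m => f (3 * m - 1)) c) :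
    HasSum f (a + b + c) := by
  have key {g : ℤ → ℤ} {r : ℤ} {s : ℂ} (hinj : Function.Injective g)
      (hg : ∀ j, j % 3 = r ↔ j ∈ Set.range g) (h : HasSum (fun m => f (g m)) s) :
      HasSum (fun j => if j % 3 = r then f j else 0) s := by
    refine (hinj.hasSum_iff fun j hj => if_neg (mt (hg j).mp hj)).mp ?_
    refine h.congr_fun fun m => ?_
    exact if_pos ((hg _).mpr ⟨m, rfl⟩)
  have k0 := key (g := fun m => 3 * m) (r := 0) (fun x y h => by simpa using h)
    (fun j => ⟨fun h => ⟨j / 3, by dsimp only; omega⟩, by rintro ⟨m, rfl⟩; dsimp only; omega⟩) h0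
  have k1 := key (g := fun m => 3 * m + 1) (r := 1) (fun x y h => by simpa using h)
    (fun j => ⟨fun h => ⟨j / 3, by dsimp only; omega⟩, by rintro ⟨m, rfl⟩; dsimp only; omega⟩) h1
  have k2 := key (g := fun m => 3 * m - 1) (r := 2) (fun x y h => by simpa using h)
    (fun j => ⟨fun h => ⟨j / 3 + 1, by dsimp only; omega⟩, by rintro ⟨m, rfl⟩; dsimp only; omega⟩)
    h2
  refine ((k0.add k1).add k2).congr_fun fun j => ?_
  have : j % 3 = 0 ∨ j % 3 = 1 ∨ j % 3 = 2 := by omega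
  rcases this with h | h | h <;> simp [h]

theorem two_mul_triangle (j : ℤ) : 2 * (j * (j - 1) / 2) = j * (j - 1) :=
  Int.mul_ediv_cancel' (by
    rcases Int.even_or_odd j with h | h
    · exact h.two_dvd.mul_right _
    · exact (h.sub_odd odd_one).two_dvd.mul_left _)

theorem jacobiTerm_pow {q : ℂ} (hq : q ≠ 0) (a b : ℕ) (j : ℤ) :
    jacobiTerm (q ^ a) (q ^ b) j = (-1) ^ j * q ^ (a * (j * (j - 1) / 2) + b * j) := by
  rw [jacobiTerm, ← zpow_natCast q a, ← zpow_natCast q b, ← zpow_mul, ← zpow_mul, mul_assoc,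
    zpow_add₀ hq]

theorem jacobiTerm_neg_pow {q : ℂ} (hq : q ≠ 0) (a b : ℕ) (j : ℤ) :
    jacobiTerm (q ^ a) (-q ^ b) j = q ^ (a * (j * (j - 1) / 2) + b * j) := by
  have h : jacobiTerm (q ^ a) (-q ^ b) j = (-1) ^ j * jacobiTerm (q ^ a) (q ^ b) j := by
    rw [jacobiTerm, jacobiTerm, ← neg_one_mul (q ^ b), mul_zpow]
    ring
  rw [h, jacobiTerm_pow hq, ← mul_assoc, ← mul_zpow]
  norm_num

theorem thetaPhi_dissection {q : ℂ} (hq : ‖q‖ < 1) (hq0 : q ≠ 0) :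
    thetaPhi q = thetaPhi (q ^ 9) - 2 * q * thetaOmega (q ^ 3) := by
  have hn (n : ℕ) (h : n ≠ 0 := by norm_num) : ‖q ^ n‖ < 1 := norm_pow_lt_one hq h
  have h0 (n : ℕ) : q ^ n ≠ 0 := pow_ne_zero n hq0
  have hf := hasSum_jacobiTerm (hn 2) (h0 2) (h0 1)
  have g0 := hasSum_jacobiTerm (hn 18) (h0 18) (h0 9)
  have g1 := (hasSum_jacobiTerm (hn 18) (h0 18) (h0 15)).mul_left (-q)
  -- The series is ∑ (-1)^j q^(j²), whose exponents at j = 3m - 1 are those at 3m + 1 with m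
  -- negated. Both classes therefore have the same sum, hence the coefficient 2.
  have g2 := (Equiv.neg ℤ).hasSum_iff.mpr g1
  have hdiv (a b c : ℕ) (h : a = c + b) : q ^ a / q ^ b = q ^ c := by
    rw [h, pow_add, mul_div_cancel_right₀ _ (h0 b)]
  rw [hdiv 2 1 1 rfl] at hf
  rw [hdiv 18 9 9 rfl] at g0
  rw [hdiv 18 15 3 rfl] at g1 g2
  have e := hf.unique (HasSum.int_mod_three (g0.congr_fun fun m => ?_) (g1.congr_fun fun m => ?_)
    (g2.congr_fun fun m => ?_))
  · rw [thetaPhi, thetaPhi, thetaOmega]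
    simp only [← pow_mul, pow_one] at e ⊢
    norm_num at e ⊢
    linear_combination e
  · rw [jacobiTerm_pow hq0, jacobiTerm_pow hq0, zpow_mul]
    congr 2
    · norm_num
    · have t1 := two_mul_triangle (3 * m)
      have t2 := two_mul_triangle m
      push_cast
      linear_combination t1 - 9 * t2
  · rw [jacobiTerm_pow hq0, jacobiTerm_pow hq0, zpow_add₀ (by norm_num), zpow_mul,
      show -q * ((-1) ^ m * q ^ (((18 : ℕ) : ℤ) * (m * (m - 1) / 2) + ((15 : ℕ) : ℤ) * m)) =
        -(-1) ^ m * q ^ (((18 : ℕ) : ℤ) * (m * (m - 1) / 2) + ((15 : ℕ) : ℤ) * m + 1) by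
        rw [zpow_add_one₀ hq0]; ring]
    congr 2
    · norm_num
    · have t1 := two_mul_triangle (3 * m + 1)
      have t2 := two_mul_triangle m
      push_cast
      linear_combination t1 - 9 * t2
  · simp only [Function.comp, Equiv.neg_apply]
    rw [jacobiTerm_pow hq0, jacobiTerm_pow hq0, zpow_sub₀ (by norm_num), zpow_mul,
      show -q * ((-1) ^ (-m) * q ^ (((18 : ℕ) : ℤ) * (-m * (-m - 1) / 2) + ((15 : ℕ) : ℤ) * -m)) =
        -(-1) ^ (-m) * q ^ (((18 : ℕ) : ℤ) * (-m * (-m - 1) / 2) + ((15 : ℕ) : ℤ) * -m + 1) by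
        rw [zpow_add_one₀ hq0]; ring]
    congr 2
    · rw [← inv_zpow']
      norm_num [div_neg]
    · have t1 := two_mul_triangle (3 * m - 1)
      have t2 := two_mul_triangle (-m)
      push_cast
      linear_combination t1 - 9 * t2

theorem thetaPsi_dissection {q : ℂ} (hq : ‖q‖ < 1) (hq0 : q ≠ 0) :
    thetaPsi q = thetaA (q ^ 3) + q * thetaPsi (q ^ 9) := by
  have hn (n : ℕ) (h : n ≠ 0 := by norm_num) : ‖q ^ n‖ < 1 := norm_pow_lt_one hq h
  have h0 (n : ℕ) : q ^ n ≠ 0 := pow_ne_zero n hq0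
  have hf := hasSum_jacobiTerm (hn 1) (h0 1) (neg_ne_zero.mpr (h0 1))
  have g0 := hasSum_jacobiTerm (hn 9) (h0 9) (neg_ne_zero.mpr (h0 6))
  have g1 := (hasSum_jacobiTerm (hn 9) (h0 9) (neg_ne_zero.mpr (h0 9))).mul_left q
  have g2 := hasSum_jacobiTerm (hn 9) (h0 9) (neg_ne_zero.mpr (h0 3))
  have hdiv (a b c : ℕ) (h : a = c + b) : q ^ a / -q ^ b = -q ^ c := by
    rw [h, pow_add, div_neg, mul_div_cancel_right₀ _ (h0 b)]
  -- The sum of q^(j(j+1)/2) over ℤ counts every term of ψ twice (j and -1 - j). On the product side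
  -- this 2 is the leading factor of (-1;x)_∞.
  have hone (x : ℂ) (hx : ‖x‖ < 1) : qPochhammerInf (-x ^ 0) x = 2 * qPochhammerInf (-x) x := by
    rw [qPochhammerInf_eq_one_sub_mul _ hx]
    norm_num
  rw [hdiv 1 1 0 rfl] at hf
  rw [hdiv 9 6 3 rfl] at g0
  rw [hdiv 9 9 0 rfl] at g1
  rw [hdiv 9 3 6 rfl] at g2
  have e := hf.unique (HasSum.int_mod_three (g0.congr_fun fun m => ?_) (g1.congr_fun fun m => ?_)
    (g2.congr_fun fun m => ?_))
  · have e1 := hone _ (hn 1)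
    have e9 := hone _ (hn 9)
    rw [thetaPsi, thetaPsi, thetaA]
    simp only [← pow_mul, pow_one, pow_zero] at e e1 e9 ⊢
    rw [e1, e9] at e
    norm_num at e ⊢
    linear_combination e / 2
  · rw [jacobiTerm_neg_pow hq0, jacobiTerm_neg_pow hq0]
    congr 1
    have t1 := two_mul_triangle (3 * m)
    have t2 := two_mul_triangle m
    refine mul_left_cancel₀ two_ne_zero ?_
    push_cast
    linear_combination t1 - 9 * t2
  · rw [jacobiTerm_neg_pow hq0, jacobiTerm_neg_pow hq0, mul_comm q, ← zpow_add_one₀ hq0]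
    congr 1
    have t1 := two_mul_triangle (3 * m + 1)
    have t2 := two_mul_triangle m
    refine mul_left_cancel₀ two_ne_zero ?_
    push_cast
    linear_combination t1 - 9 * t2
  · rw [jacobiTerm_neg_pow hq0, jacobiTerm_neg_pow hq0]
    congr 1
    have t1 := two_mul_triangle (3 * m - 1)
    have t2 := two_mul_triangle m
    refine mul_left_cancel₀ two_ne_zero ?_
    push_cast
    linear_combination t1 - 9 * t2

/-! ### The product E(q) and its values at cube-root rotations -/

/-- The reciprocal of the generating function of cubic partitions. -/
noncomputable def eulerPair (q : ℂ) : ℂ :=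
  qPochhammerInf q q * qPochhammerInf (q ^ 2) (q ^ 2)

theorem eulerPair_ne_zero {q : ℂ} (hq : ‖q‖ < 1) : eulerPair q ≠ 0 :=
  have h2 := norm_pow_lt_one hq two_ne_zero
  mul_ne_zero (qPochhammerInf_ne_zero hq hq) (qPochhammerInf_ne_zero h2 h2)

/-- The 3-dissection of `(q; q)_∞ (q²; q²)_∞`. -/
theorem eulerPair_dissection {q : ℂ} (hq : ‖q‖ < 1) (hq0 : q ≠ 0) :
    eulerPair q = thetaPhi (q ^ 9) * thetaA (q ^ 3) - q * eulerPair (q ^ 9) -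
      2 * q ^ 2 * (thetaOmega (q ^ 3) * thetaPsi (q ^ 9)) := by
  have h3 := thetaOmega_mul_thetaA (norm_pow_lt_one hq three_ne_zero)
  have h9 := thetaPhi_mul_thetaPsi (norm_pow_lt_one hq (n := 9) (by norm_num))
  have h : thetaPhi q * thetaPsi q = eulerPair q := thetaPhi_mul_thetaPsi hq
  rw [thetaPhi_dissection hq hq0, thetaPsi_dissection hq hq0] at h
  rw [← h, eulerPair]
  simp only [← pow_mul] at h3 h9 ⊢
  norm_num at h3 h9 ⊢
  -- The cross terms φψ and ΩA both equal E(q⁹), so the middle coefficient is q - 2q = -q.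
  linear_combination q * h9 - 2 * q * h3

/-- Regrouped as (φψ)(ΩA), the product is two copies of E(q⁹). -/
theorem theta_mul_theta {q : ℂ} (hq : ‖q‖ < 1) :
    (thetaPhi (q ^ 9) * thetaA (q ^ 3)) * (thetaOmega (q ^ 3) * thetaPsi (q ^ 9)) =
      eulerPair (q ^ 9) ^ 2 := by
  have h3 := thetaOmega_mul_thetaA (norm_pow_lt_one hq three_ne_zero)
  have h9 : _ = eulerPair (q ^ 9) :=
    thetaPhi_mul_thetaPsi (norm_pow_lt_one hq (n := 9) (by norm_num))
  have h3' : thetaOmega (q ^ 3) * thetaA (q ^ 3) = eulerPair (q ^ 9) := by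
    rw [h3, eulerPair]
    simp only [← pow_mul]
  rw [sq]
  nth_rw 1 [← h3', ← h9]
  ring

/-- Exponents divisible by 3 give (q³;q³)_∞ at each of the three rotations. For the other k the
three factors multiply to 1 - q^(3k), giving (q³;q³)_∞ without its (q⁹;q⁹)_∞ part. -/
theorem qPochhammerInf_self_mul_cube_roots {ω : ℂ} (hω : 1 + ω + ω ^ 2 = 0) {q : ℂ}
    (hq : ‖q‖ < 1) :
    qPochhammerInf q q * qPochhammerInf (ω * q) (ω * q) * qPochhammerInf (ω ^ 2 * q) (ω ^ 2 * q) *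
      qPochhammerInf (q ^ 9) (q ^ 9) = qPochhammerInf (q ^ 3) (q ^ 3) ^ 4 := by
  have hω3 : ω ^ 3 = 1 := by linear_combination (ω - 1) * hω
  have hn : ‖ω‖ = 1 := Complex.norm_eq_one_of_pow_eq_one hω3 three_ne_zero
  have h3 := norm_pow_lt_one hq three_ne_zero
  have s0 := qPochhammerInf_split_three q hq
  have s1 := qPochhammerInf_split_three (ω * q) (q := ω * q) (by simpa [hn] using hq)
  have s2 := qPochhammerInf_split_three (ω ^ 2 * q) (q := ω ^ 2 * q) (by simpa [hn] using hq)
  have r1 := qPochhammerInf_mul_cube_roots hω q h3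
  have r2 := qPochhammerInf_mul_cube_roots hω (q ^ 2) h3
  have s3 := qPochhammerInf_split_three (q ^ 3) h3
  have p1 : (ω * q) ^ 3 = q ^ 3 := by rw [mul_pow, hω3, one_mul]
  have p2 : (ω ^ 2 * q) ^ 3 = q ^ 3 := by rw [mul_pow, ← pow_mul, mul_comm 2 3, pow_mul, hω3]; ring
  rw [p1, ← pow_succ', p1, ← sq, mul_pow] at s1
  rw [p2, ← pow_succ', p2, ← sq, mul_pow,
    show (ω ^ 2) ^ 2 = ω by linear_combination ω * hω3] at s2
  rw [← pow_succ', ← sq] at s0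
  simp only [← pow_mul, ← pow_add] at r1 r2 s3
  norm_num at r1 r2 s3
  rw [s0, s1, s2]
  rw [← r1, ← r2] at s3
  linear_combination (-qPochhammerInf (q ^ 3) (q ^ 3) ^ 3) * s3

theorem eulerPair_mul_cube_roots {ω : ℂ} (hω : 1 + ω + ω ^ 2 = 0) {q : ℂ} (hq : ‖q‖ < 1) :
    eulerPair q * eulerPair (ω * q) * eulerPair (ω ^ 2 * q) * eulerPair (q ^ 9) =
      eulerPair (q ^ 3) ^ 4 := by
  have hω3 : ω ^ 3 = 1 := by linear_combination (ω - 1) * hω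
  have h1 := qPochhammerInf_self_mul_cube_roots hω hq
  have h2 := qPochhammerInf_self_mul_cube_roots hω (norm_pow_lt_one hq two_ne_zero)
  simp only [eulerPair]
  rw [mul_pow ω q, mul_pow (ω ^ 2) q, show (ω ^ 2) ^ 2 = ω by linear_combination ω * hω3,
    ← pow_mul q 9 2, mul_comm 9 2, pow_mul q 2 9, ← pow_mul q 3 2, mul_comm 3 2, pow_mul q 2 3,
    mul_pow, ← h1, ← h2]
  ring

/-! ### From formal power series to analytic values -/

/-- The power series `A` converges absolutely at `q`, with value `v`. -/
def HasEval (A : PowerSeries ℕ) (q v : ℂ) : Prop :=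
  (Summable fun n => ‖(A.coeff n : ℂ) * q ^ n‖) ∧ HasSum (fun n => (A.coeff n : ℂ) * q ^ n) v

theorem hasEval_one (q : ℂ) : HasEval 1 q 1 := by
  have h (n : ℕ) (hn : n ≠ 0) : ((PowerSeries.coeff n (1 : PowerSeries ℕ) : ℕ) : ℂ) * q ^ n = 0 := by
    simp [PowerSeries.coeff_one, hn]
  constructor
  · refine summable_of_ne_finset_zero (s := {0}) fun n hn => ?_
    rw [h n (by simpa using hn), norm_zero]
  · simpa using hasSum_single 0 h

theorem HasEval.mul {A B : PowerSeries ℕ} {q a b : ℂ} (hA : HasEval A q a) (hB : HasEval B q b) :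
    HasEval (A * B) q (a * b) := by
  have h (n : ℕ) : ∑ kl ∈ antidiagonal n,
      ((A.coeff kl.1 : ℂ) * q ^ kl.1) * ((B.coeff kl.2 : ℂ) * q ^ kl.2) =
      ((A * B).coeff n : ℂ) * q ^ n := by
    rw [PowerSeries.coeff_mul, Nat.cast_sum, sum_mul]
    refine sum_congr rfl fun kl hkl => ?_
    rw [← mem_antidiagonal.mp hkl, pow_add]
    push_cast
    ring
  have h1 := summable_norm_sum_mul_antidiagonal_of_summable_norm hA.1 hB.1
  have h2 := tsum_mul_tsum_eq_tsum_sum_antidiagonal_of_summable_norm hA.1 hB.1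
  rw [hA.2.tsum_eq, hB.2.tsum_eq] at h2
  simp only [h] at h1 h2
  exact ⟨h1, h2 ▸ h1.of_norm.hasSum⟩

theorem HasEval.prod {A : ℕ → PowerSeries ℕ} {q : ℂ} {a : ℕ → ℂ} (h : ∀ i, HasEval (A i) q (a i))
    (N : ℕ) : HasEval (∏ i ∈ range N, A i) q (∏ i ∈ range N, a i) := by
  induction N with
  | zero => simpa using hasEval_one q
  | succ N ih =>
    rw [prod_range_succ, prod_range_succ]
    exact ih.mul (h N)

open scoped PowerSeries.WithPiTopology in
/-- Evaluation commutes with monotone limits of power series with natural coefficients, as long as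
the values at `‖q‖` stay bounded. -/
theorem HasEval.of_tendsto {P : ℕ → PowerSeries ℕ} {A : PowerSeries ℕ} {q L : ℂ} {v w : ℕ → ℂ}
    {C : ℝ} (hmono : ∀ n, Monotone fun N => (P N).coeff n) (hP : Tendsto P atTop (𝓝 A))
    (hv : ∀ N, HasEval (P N) q (v N)) (hL : Tendsto v atTop (𝓝 L))
    (hw : ∀ N, HasEval (P N) (‖q‖ : ℂ) (w N)) (hC : ∀ N, ‖w N‖ ≤ C) : HasEval A q L := by
  rw [PowerSeries.WithPiTopology.tendsto_iff_coeff_tendsto] at hP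
  have hev (n : ℕ) : ∀ᶠ N in atTop, (P N).coeff n = A.coeff n := by
    have := hP n
    rwa [nhds_discrete, tendsto_pure] at this
  have hle (n N : ℕ) : (P N).coeff n ≤ A.coeff n := (hmono n).ge_of_tendsto (hP n) N
  have hsum : Summable fun n => ‖(A.coeff n : ℂ) * q ^ n‖ := by
    -- The first M coefficients of `P N` have stabilised for some N, so the partial sum is at most
    -- the value of `P N` at ‖q‖.
    refine summable_of_sum_range_le (c := C) (fun n => norm_nonneg _) fun M => ?_
    obtain ⟨N, hN⟩ := ((eventually_all_finset (range M)).mpr fun n _ => hev n).exists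
    have hre : HasSum (fun n => ‖((P N).coeff n : ℂ) * q ^ n‖) (w N).re := by
      refine (Complex.reCLM.hasSum (hw N).2).congr_fun fun n => ?_
      have : ((P N).coeff n : ℂ) * (‖q‖ : ℂ) ^ n = ((((P N).coeff n : ℝ) * ‖q‖ ^ n : ℝ) : ℂ) := by
        push_cast
        rfl
      rw [Complex.reCLM_apply, this, Complex.ofReal_re, norm_mul, norm_pow, Complex.norm_natCast]
    calc ∑ n ∈ range M, ‖(A.coeff n : ℂ) * q ^ n‖
        = ∑ n ∈ range M, ‖((P N).coeff n : ℂ) * q ^ n‖ :=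
          sum_congr rfl fun n hn => by rw [hN n hn]
      _ ≤ (w N).re := sum_le_hasSum _ (fun n _ => norm_nonneg _) hre
      _ ≤ C := (Complex.re_le_norm _).trans (hC N)
  refine ⟨hsum, ?_⟩
  have key : Tendsto (fun N => ∑' n, ((P N).coeff n : ℂ) * q ^ n) atTop
      (𝓝 (∑' n, (A.coeff n : ℂ) * q ^ n)) := by
    refine tendsto_tsum_of_dominated_convergence hsum (fun n => ?_) ?_
    · exact tendsto_nhds_of_eventually_eq ((hev n).mono fun N hN => by rw [hN])
    · refine Eventually.of_forall fun N n => ?_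
      rw [norm_mul, norm_mul, Complex.norm_natCast, Complex.norm_natCast]
      gcongr
      exact hle n N
  rw [← tendsto_nhds_unique key (hL.congr fun N => ((hv N).2.tsum_eq).symm)]
  exact hsum.of_norm.hasSum

/-! ### Generating functions of partitions -/

/-- The factor contributed by the part `i + 1` to the generating function of the partitions whose
parts satisfy `p`. -/
noncomputable def partFactor (p : ℕ → Prop) [DecidablePred p] (i : ℕ) : PowerSeries ℕ :=
  if p (i + 1) then PowerSeries.mk fun n => if i + 1 ∣ n then 1 else 0 else 1

theorem coeff_zero_partFactor (p : ℕ → Prop) [DecidablePred p] (i : ℕ) :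
    (partFactor p i).coeff 0 = 1 := by
  unfold partFactor
  split_ifs <;> simp

open scoped PowerSeries.WithPiTopology in
theorem hasProd_partFactor (p : ℕ → Prop) [DecidablePred p] :
    HasProd (partFactor p) (PowerSeries.mk fun n => (Nat.Partition.restricted n p).card) := by
  convert! Nat.Partition.hasProd_powerSeriesMk_card_restricted ℕ p using 1
  funext i
  unfold partFactor
  congr 1
  have hs : Summable fun j : ℕ => (PowerSeries.X : PowerSeries ℕ) ^ ((i + 1) * j) := by
    simp_rw [pow_mul]
    exact PowerSeries.WithPiTopology.summable_pow_of_constantCoeff_eq_zero (by simp)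
  ext n
  rw [hs.map_tsum _ (PowerSeries.WithPiTopology.continuous_coeff _ n), PowerSeries.coeff_mk]
  simp only [PowerSeries.coeff_X_pow]
  split_ifs with h
  · obtain ⟨k, rfl⟩ := h
    rw [tsum_eq_single k fun j hj => if_neg fun h => hj (by simpa using h.symm), if_pos rfl]
  · symm
    convert tsum_zero with j
    exact if_neg fun hj => h ⟨j, hj⟩

theorem hasEval_partFactor (p : ℕ → Prop) [DecidablePred p] (i : ℕ) {q : ℂ} (hq : ‖q‖ < 1) :
    HasEval (partFactor p i) q (if p (i + 1) then (1 - q ^ (i + 1))⁻¹ else 1) := by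
  unfold partFactor
  split_ifs
  · have hinj : Function.Injective fun j : ℕ => (i + 1) * j := fun a b h => by simpa using h
    have hzero (x : ℂ) (n : ℕ) (hn : n ∉ Set.range fun j : ℕ => (i + 1) * j) :
        (((PowerSeries.mk fun n => if i + 1 ∣ n then 1 else 0 : PowerSeries ℕ).coeff n : ℕ) : ℂ) *
          x ^ n = 0 := by
      rw [PowerSeries.coeff_mk, if_neg, Nat.cast_zero, zero_mul]
      rintro ⟨k, rfl⟩
      exact hn ⟨k, rfl⟩
    have hi := norm_pow_lt_one hq i.succ_ne_zero
    constructor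
    · refine (hinj.summable_iff fun n hn => ?_).mp ?_
      · rw [hzero q n hn, norm_zero]
      · refine (summable_geometric_of_lt_one (norm_nonneg _) hi).congr fun j => ?_
        simp [PowerSeries.coeff_mk, pow_mul]
    · refine (hinj.hasSum_iff (hzero q)).mp ?_
      refine (hasSum_geometric_of_norm_lt_one hi).congr_fun fun j => ?_
      simp [PowerSeries.coeff_mk, pow_mul]
  · exact hasEval_one q

/-- With coefficients in ℕ, a factor with constant term 1 keeps the old coefficient and can only add
to it. -/
theorem monotone_coeff_prod_range {A : ℕ → PowerSeries ℕ} (h : ∀ i, (A i).coeff 0 = 1) (n : ℕ) :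
    Monotone fun N => (∏ i ∈ range N, A i).coeff n := by
  refine monotone_nat_of_le_succ fun N => ?_
  rw [prod_range_succ, PowerSeries.coeff_mul]
  refine le_trans (le_of_eq ?_) (single_le_sum (f := fun kl : ℕ × ℕ =>
    (∏ i ∈ range N, A i).coeff kl.1 * (A N).coeff kl.2) (fun _ _ => Nat.zero_le _)
    (mem_antidiagonal.mpr (add_zero n) : (n, 0) ∈ antidiagonal n))
  rw [h, mul_one]

-- The limit `g` is required on the whole disc because it is used twice: at q for the value, and at
-- ‖q‖ for the bound in `HasEval.of_tendsto`.
open scoped PowerSeries.WithPiTopology in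
theorem hasEval_card_restricted (p : ℕ → Prop) [DecidablePred p] {q : ℂ} (hq : ‖q‖ < 1) {g : ℂ → ℂ}
    (hg : ∀ x : ℂ, ‖x‖ < 1 → Tendsto
      (fun N => ∏ i ∈ range N, if p (i + 1) then (1 - x ^ (i + 1))⁻¹ else 1) atTop (𝓝 (g x))) :
    HasEval (PowerSeries.mk fun n => (Nat.Partition.restricted n p).card) q (g q) := by
  have hq' : ‖(‖q‖ : ℂ)‖ < 1 := by simpa using hq
  obtain ⟨C, hC⟩ := (hg _ hq').norm.bddAbove_range
  exact HasEval.of_tendsto (monotone_coeff_prod_range (coeff_zero_partFactor p))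
    (hasProd_partFactor p).tendsto_prod_nat
    (HasEval.prod fun i => hasEval_partFactor p i hq) (hg q hq)
    (HasEval.prod fun i => hasEval_partFactor p i hq') fun N => hC ⟨N, rfl⟩

theorem tendsto_prod_inv_one_sub_pow {q : ℂ} (hq : ‖q‖ < 1) :
    Tendsto (fun N => ∏ i ∈ range N, (1 - q ^ (i + 1))⁻¹) atTop (𝓝 (qPochhammerInf q q)⁻¹) := by
  simpa [pow_succ'] using (tendsto_qPochhammerInf q hq).inv₀ (qPochhammerInf_ne_zero hq hq)

theorem tendsto_prod_inv_one_sub_pow_even {q : ℂ} (hq : ‖q‖ < 1) :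
    Tendsto (fun N => ∏ i ∈ range N, if Even (i + 1) then (1 - q ^ (i + 1))⁻¹ else 1) atTop
      (𝓝 (qPochhammerInf (q ^ 2) (q ^ 2))⁻¹) := by
  -- Exactly N / 2 of the parts 1, …, N are even.
  refine ((tendsto_prod_inv_one_sub_pow (norm_pow_lt_one hq two_ne_zero)).comp
    (Nat.tendsto_div_const_atTop two_ne_zero)).congr fun N => ?_
  simp only [Function.comp]
  induction N with
  | zero => simp
  | succ N ih =>
    rw [prod_range_succ, ← ih]
    split_ifs with h
    · obtain ⟨k, hk⟩ := h
      obtain ⟨m, rfl⟩ : ∃ m, k = m + 1 := ⟨k - 1, by omega⟩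
      rw [show (N + 1) / 2 = m + 1 by omega, show N / 2 = m by omega, prod_range_succ, ← pow_mul,
        show 2 * (m + 1) = N + 1 by omega]
    · rw [Nat.not_even_iff_odd] at h
      obtain ⟨k, hk⟩ := h
      rw [show (N + 1) / 2 = k by omega, show N / 2 = k by omega, mul_one]

/-- The generating function of cubic partitions. -/
theorem hasSum_cubicPartitionCount {q : ℂ} (hq : ‖q‖ < 1) :
    HasSum (fun n => (cubicPartitionCount n : ℂ) * q ^ n) (eulerPair q)⁻¹ := by
  have h1 := hasEval_card_restricted (fun _ => True) hq
    (fun x hx => by simpa using tendsto_prod_inv_one_sub_pow hx)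
  have h2 := hasEval_card_restricted Even hq (fun x hx => tendsto_prod_inv_one_sub_pow_even hx)
  have h := (h1.mul h2).2
  rw [← mul_inv] at h
  refine h.congr_fun fun n => ?_
  rw [PowerSeries.coeff_mul, cubicPartitionCount]
  simp [Nat.Partition.restricted]

theorem tprod_eq_inv_eulerPair {q : ℂ} (hq : ‖q‖ < 1) :
    ∏' n : ℕ, 1 / ((1 - q ^ (n + 1)) * (1 - q ^ (2 * (n + 1)))) = (eulerPair q)⁻¹ := by
  have h2 := norm_pow_lt_one hq two_ne_zero
  have h := ((hasProd_qPochhammerInf q hq).mul (hasProd_qPochhammerInf (q ^ 2) h2)).inv₀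
    (eulerPair_ne_zero hq)
  rw [← eulerPair] at h
  rw [← h.tprod_eq]
  refine tprod_congr fun n => ?_
  rw [one_div, pow_mul, pow_succ', pow_succ']

/-! ### Extracting the exponents 2 mod 3 -/

/-- The weights 1, ω, ω² multiply the n-th term by 1 + ω^(n+1) + ω^(2(n+1)), which is 3 if n is 2
mod 3 and 0 otherwise. -/
theorem HasSum.arithmetic_progression_three {f : ℕ → ℂ} {ω q s0 s1 s2 : ℂ}
    (hω : 1 + ω + ω ^ 2 = 0) (h0 : HasSum (fun n => f n * q ^ n) s0)
    (h1 : HasSum (fun n => f n * (ω * q) ^ n) s1) (h2 : HasSum (fun n => f n * (ω ^ 2 * q) ^ n) s2) :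
    HasSum (fun n => f (3 * n + 2) * q ^ (3 * n + 2)) ((s0 + ω * s1 + ω ^ 2 * s2) / 3) := by
  have hω3 : ω ^ 3 = 1 := by linear_combination (ω - 1) * hω
  have hinj : Function.Injective fun n : ℕ => 3 * n + 2 := fun a b h => by simpa using h
  have hpow (k : ℕ) : ω ^ (3 * k) = 1 := by rw [pow_mul, hω3, one_pow]
  have h := ((h0.add (h1.mul_left ω)).add (h2.mul_left (ω ^ 2))).div_const 3
  refine ((hinj.hasSum_iff fun n hn => ?_).mpr h).congr_fun fun n => ?_
  · have hn' : n % 3 = 0 ∨ n % 3 = 1 := by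
      by_contra hc
      exact hn ⟨n / 3, by dsimp only; omega⟩
    obtain ⟨m, rfl | rfl⟩ : ∃ m, n = 3 * m ∨ n = 3 * m + 1 := ⟨n / 3, by omega⟩
    · rw [mul_pow, mul_pow, ← pow_mul ω 2, mul_left_comm 2 3, hpow, hpow]
      linear_combination f (3 * m) * q ^ (3 * m) / 3 * hω
    · rw [mul_pow, mul_pow, ← pow_mul ω 2, mul_add 2, mul_left_comm 2 3, pow_add ω, pow_add ω, hpow,
        hpow]
      linear_combination f (3 * m + 1) * q ^ (3 * m + 1) / 3 * (hω + ω * hω3)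
  · simp only [Function.comp]
    rw [mul_pow, mul_pow, ← pow_mul ω 2, mul_add 2, mul_left_comm 2 3, pow_add ω, pow_add ω, hpow,
      hpow]
    linear_combination -f (3 * n + 2) * q ^ (3 * n + 2) / 3 * (2 + ω ^ 3) * hω3

theorem hasSum_cubicPartitionCount_three_mul_add_two {q : ℂ} (hq : ‖q‖ < 1) (hq0 : q ≠ 0) :
    HasSum (fun n => (cubicPartitionCount (3 * n + 2) : ℂ) * q ^ (3 * n + 2))
      (3 * q ^ 2 * (eulerPair (q ^ 9) ^ 3 / eulerPair (q ^ 3) ^ 4)) := by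
  obtain ⟨ω, hω⟩ : ∃ ω : ℂ, 1 + ω + ω ^ 2 = 0 := by
    obtain ⟨s, hs⟩ := IsAlgClosed.exists_pow_nat_eq (-3 : ℂ) two_pos
    exact ⟨(-1 + s) / 2, by linear_combination hs / 4⟩
  have hω3 : ω ^ 3 = 1 := by linear_combination (ω - 1) * hω
  have hω0 : ω ≠ 0 := by rintro rfl; simp at hω
  have hnorm : ‖ω‖ = 1 := Complex.norm_eq_one_of_pow_eq_one hω3 three_ne_zero
  have hq1 : ‖ω * q‖ < 1 := by simpa [hnorm] using hq
  have hq2 : ‖ω ^ 2 * q‖ < 1 := by simpa [hnorm] using hq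
  convert HasSum.arithmetic_progression_three hω (hasSum_cubicPartitionCount hq)
    (hasSum_cubicPartitionCount hq1) (hasSum_cubicPartitionCount hq2) using 1
  have d0 := eulerPair_dissection hq hq0
  have d1 := eulerPair_dissection hq1 (mul_ne_zero hω0 hq0)
  have d2 := eulerPair_dissection hq2 (mul_ne_zero (pow_ne_zero 2 hω0) hq0)
  have hc := theta_mul_theta hq
  have hN := eulerPair_mul_cube_roots hω hq
  have n0 := eulerPair_ne_zero hq
  have n1 := eulerPair_ne_zero hq1
  have n2 := eulerPair_ne_zero hq2
  have n9 := eulerPair_ne_zero (norm_pow_lt_one hq (n := 9) (by norm_num))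
  have p3 : (ω * q) ^ 3 = q ^ 3 := by rw [mul_pow, hω3, one_mul]
  have p3' : (ω ^ 2 * q) ^ 3 = q ^ 3 := by rw [mul_pow, pow_right_comm, hω3]; ring
  have p9 : (ω * q) ^ 9 = q ^ 9 := by rw [pow_mul _ 3 3, p3]; ring
  have p9' : (ω ^ 2 * q) ^ 9 = q ^ 9 := by rw [pow_mul _ 3 3, p3']; ring
  rw [p3, p9] at d1
  rw [p3', p9'] at d2
  rw [← hN]
  generalize thetaPhi (q ^ 9) * thetaA (q ^ 3) = a at *
  generalize thetaOmega (q ^ 3) * thetaPsi (q ^ 9) = c at *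
  generalize eulerPair (q ^ 9) = r at *
  generalize eulerPair q = x at *
  generalize eulerPair (ω * q) = y at *
  generalize eulerPair (ω ^ 2 * q) = z at *
  -- With B = -qr and C = -2q²c, yz = a² + B² + C² - aB - aC - BC. The weighted sum keeps its
  -- exponents 2 mod 3, namely 3(B² - aC), and `hc` turns ac into r².
  have key : y * z + ω * (x * z) + ω ^ 2 * (x * y) = 9 * q ^ 2 * r ^ 2 := by
    have hω2 : ω ^ 2 = -1 - ω := by linear_combination hω
    have hω4 : (ω ^ 2) ^ 2 = ω := by linear_combination ω * hω3
    rw [mul_pow, hω2] at d1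
    rw [mul_pow, hω4, hω2] at d2
    rw [hω2, d0, d1, d2]
    linear_combination 6 * q ^ 2 * hc + (-(2 * q ^ 2 * c - q * r) ^ 2 -
      2 * (2 * q ^ 2 * c - q * r) * (a - q * r - 2 * q ^ 2 * c)) * hω
  field_simp
  linear_combination -key

/-! ### The value a(2), and the conclusion -/

theorem Multiset.eq_zero_of_sum_eq_zero {s : Multiset ℕ} (hs : s.sum = 0) (hpos : ∀ x ∈ s, 0 < x) :
    s = 0 :=
  Multiset.eq_zero_of_forall_notMem fun x hx =>
    (hpos x hx).ne' (Nat.le_zero.mp (hs ▸ Multiset.le_sum_of_mem hx))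

theorem Nat.Partition.univ_two : (univ : Finset (Nat.Partition 2)) =
    {⟨{2}, by simp, by simp⟩, ⟨{1, 1}, by simp, by simp⟩} := by
  refine (eq_univ_of_forall fun p => ?_).symm
  obtain ⟨s, hpos, hsum⟩ := p
  simp only [mem_insert, mem_singleton, Nat.Partition.mk.injEq]
  induction s using Multiset.induction with
  | empty => simp at hsum
  | cons x t _ =>
    have hx : 0 < x := hpos (by simp)
    have ht : ∀ y ∈ t, 0 < y := fun y hy => hpos (by simp [hy])
    rw [Multiset.sum_cons] at hsum
    obtain rfl | rfl : x = 2 ∨ x = 1 := by omega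
    · left
      rw [Multiset.eq_zero_of_sum_eq_zero (by omega) ht]
      rfl
    · right
      induction t using Multiset.induction with
      | empty => simp at hsum
      | cons y u _ =>
        have hy : 0 < y := ht y (by simp)
        rw [Multiset.sum_cons] at hsum
        obtain rfl : y = 1 := by omega
        rw [Multiset.eq_zero_of_sum_eq_zero (s := u) (by omega) fun z hz => ht z (by simp [hz])]
        rfl

theorem cubicPartitionCount_two : cubicPartitionCount 2 = 3 := by
  have h1 : (Nat.Partition.restricted 1 Even).card = 0 := by
    simp [Nat.Partition.restricted]
  have h2 : Fintype.card (Nat.Partition 2) = 2 := by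
    rw [← card_univ, Nat.Partition.univ_two]
    rfl
  have h3 : (Nat.Partition.restricted 2 Even).card = 1 := by
    rw [Nat.Partition.restricted, Nat.Partition.univ_two]
    rfl
  have h4 : (Nat.Partition.restricted 0 Even).card = 1 := by
    simp [Nat.Partition.restricted]
  simp [cubicPartitionCount, Nat.antidiagonal_succ, h1, h2, h3, h4]

theorem theorem1p1 (q : ℂ) (hq : ‖q‖ < 1) :
    HasSum (fun n : ℕ => (cubicPartitionCount n : ℂ) * q ^ n)
      (∏' n : ℕ, 1 / ((1 - q ^ (n + 1)) * (1 - q ^ (2 * (n + 1))))) ∧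
    HasSum (fun n : ℕ => (cubicPartitionCount (3 * n + 2) : ℂ) * q ^ n)
      (3 * ((qPochhammerInf (q ^ 3) (q ^ 3)) ^ 3 * (qPochhammerInf (q ^ 6) (q ^ 6)) ^ 3 /
        ((qPochhammerInf q q) ^ 4 * (qPochhammerInf (q ^ 2) (q ^ 2)) ^ 4))) := by
  refine ⟨tprod_eq_inv_eulerPair hq ▸ hasSum_cubicPartitionCount hq, ?_⟩
  rcases eq_or_ne q 0 with rfl | hq0
  -- The dissections involve integer powers of q and exclude q = 0; there only the constant term
  -- a(2) = 3 survives.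
  · have hzero : qPochhammerInf 0 0 = 1 := by simp [qPochhammerInf]
    convert hasSum_single (0 : ℕ) fun n hn => ?_ using 1
    · simp [hzero, cubicPartitionCount_two]
    · simp [hn]
  -- The extracted series lives in powers of x³, so it is applied at a cube root x of q and divided
  -- by x².
  · obtain ⟨x, rfl⟩ := IsAlgClosed.exists_pow_nat_eq q (n := 3) (by norm_num)
    have hx0 : x ≠ 0 := by rintro rfl; simp at hq0
    have hx : ‖x‖ < 1 := by
      rw [norm_pow] at hq
      exact (pow_lt_one_iff_of_nonneg (norm_nonneg _) three_ne_zero).mp hq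
    refine Eq.mp (congrArg₂ (fun f s => HasSum f s) (funext fun n => ?_) ?_)
      ((hasSum_cubicPartitionCount_three_mul_add_two hx hx0).mul_left (x ^ 2)⁻¹)
    · rw [pow_add, pow_mul]
      field_simp
    · simp only [eulerPair, ← pow_mul]
      norm_num
      field_simp
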